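/- Let $\sigma_t$ be the permutation at time $t$ of a deck of $n$ cards which starts from $\sigma_0\in S_n$ and evolves by the top-to-random transposition shuffle: at every step a location $R_t$ is chosen uniformly from $\{1,\dots,n\}$, independently of the past, and the cards in location $1$ (the top) and in location $R_t$ are switched. For a set $S$ of $k$ cards let $d_S(t)$ be the maximum over $\sigma_0$ of the total variation distance between the joint law of the locations of the cards of $S$ in $\sigma_t$ and their joint law in a uniform permutation, and put $D_{n,k}(t)=\max_{|S|=k}d_S(t)$; a real time $t$ is rounded down to an integer, and a negative time is read as $0$. Let $k=k(n)$ be a sequence of non-negative integers. The shuffle is said to have $k$-partial cutoff at time $t_{\mathrm{mix}}(n)$ with a window of size $\omega(n)$ if $\omega=o(t_{\mathrm{mix}})$, \[\lim_{\alpha\to\infty}\limsup_{n\to\infty}D_{n,k}(t_{\mathrm{mix}}+\alpha\,\omega(n))=0\quad\text{and}\quad\lim_{\alpha\to-\infty}\liminf_{n\to\infty}D_{n,k}(t_{\mathrm{mix}}+\alpha\,\omega(n))=1.\] (1) If $k=o((n/\log n)^{1/2})$ and $k\to\infty$ as $n\to\infty$, then the top-to-random transposition shuffle has $k$-partial cutoff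 at time $n\log k$ with a window of size $\omega(n)=n$ (so of size $O(n)$). (2) If there is a constant $K$ with $k(n)<K$ for all $n$, then there is no cutoff: there are no real sequences $t_{\mathrm{mix}}$ and $\omega$ such that the shuffle has $k$-partial cutoff at time $t_{\mathrm{mix}}$ with a window of size $\omega$. -/

import Mathlib

open Filter Topology Asymptotics Equiv

noncomputable section

namespace CardShuffle

/-- The total variation distance `sup_A |p(A) - q(A)|` of two probability mass functions. -/
def tvDist {α : Type*} (p q : PMF α) : ℝ :=
  ⨆ A : Set α, |(p.toOuterMeasure A).toReal - (q.toOuterMeasure A).toReal|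

/-- A shuffle: for every number `n` of cards, every starting permutation and every time `t`,
the law of the permutation at time `t`.  A permutation `σ` of `Fin n` says that the card
`σ x` is in location `x`, so that the card `c` is in location `σ⁻¹ c`. -/
abbrev Shuffle : Type := (n : ℕ) → Perm (Fin n) → ℕ → PMF (Perm (Fin n))

/-- One step of the top-to-random transposition shuffle: the left hand chooses the top location
`0`, the right hand a uniform location `r`, and the cards in locations `0` and `r` are switched
(nothing happens if `r = 0`).  With no cards there is nothing to do. -/
def topToRandomStep : (n : ℕ) → Perm (Fin n) → PMF (Perm (Fin n))
  | 0, σ => PMF.pure σ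
  | m + 1, σ => (PMF.uniformOfFintype (Fin (m + 1))).map (fun r => σ * Equiv.swap 0 r)

/-- The top-to-random transposition shuffle (with independent choices of the right hand). -/
def topToRandom : Shuffle
  | _, σ₀, 0 => PMF.pure σ₀
  | n, σ₀, t + 1 => (topToRandom n σ₀ t).bind (topToRandomStep n)

/-- The joint law of the locations of the cards in `S`, for a random permutation with law `p`. -/
def locationLaw {n : ℕ} (S : Finset (Fin n)) (p : PMF (Perm (Fin n))) : PMF (S → Fin n) :=
  p.map (fun σ c => σ⁻¹ (c : Fin n))

/-- `d_S(t)`: the maximum over the starting permutations of the total variation distance between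
the joint law of the locations of the cards in `S` at time `t` and the one in a uniform
permutation. -/
def cardDist (P : Shuffle) {n : ℕ} (S : Finset (Fin n)) (t : ℕ) : ℝ :=
  ⨆ σ₀ : Perm (Fin n),
    tvDist (locationLaw S (P n σ₀ t))
      (locationLaw S (PMF.uniformOfFintype (Perm (Fin n))))

/-- The maximum of `d_S(t)` over all sets `S` of `k` of the `n` cards. A real time `t` is
rounded down to an integer (and a negative one is read as `0`). -/
def partialDist (P : Shuffle) (n k : ℕ) (t : ℝ) : ℝ :=
  ⨆ S : {S : Finset (Fin n) // S.card = k}, cardDist P S.1 ⌊t⌋₊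

/-- The shuffle `P` has `k`-partial cutoff at time `tmix` with a window of size `ω = o(tmix)`,
where `k`, `tmix` and `ω` may depend on the number `n` of cards. -/
structure HasPartialCutoff (P : Shuffle) (k : ℕ → ℕ) (tmix ω : ℕ → ℝ) : Prop where
  window : ω =o[atTop] tmix
  upper : Tendsto
    (fun α : ℝ => limsup (fun n : ℕ => partialDist P n (k n) (tmix n + α * ω n)) atTop)
    atTop (𝓝 0)
  lower : Tendsto
    (fun α : ℝ => liminf (fun n : ℕ => partialDist P n (k n) (tmix n + α * ω n)) atTop)
    atBot (𝓝 1)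

end CardShuffle

end

/-!
For the upper bound, two decks are coupled as follows: if a card of `S` is on top of one of them,
both choose the same location, which keeps the relative arrangement of the two decks; otherwise
both bring the same card to the top, which matches that card. The expected number of unmatched
cards of `S` thus decays by the factor `1 - 1 / n` per step, up to steps which see a card of `S` on
top. These cost `O(k / n)` at the start and `O(t k² / n²)` afterwards, which is negligible at
`t ≈ n log k` since `k² log n / n` tends to `0`.

For the lower bound, a card of `S` which starts below the top leaves its location only when that
location is chosen, so by the coupon collector's estimate some card of `S` is still in its initial
location at time `t` with probability at least `1 - (1 - (1 - 1 / n) ^ t) ^ k`, whereas in a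
uniform permutation this has probability at most `k / n`.

When `k ≠ 0` is bounded along a subsequence, the same two estimates show that the distance is
bounded away from `0` up to time `C n` and at most `1 / 2` from some multiple of `n` on, whereas a
window `ω = o(tmix)` would force the times at which it is near `1` and near `0` to be comparable;
for `k = 0` the distance vanishes.
-/

namespace CardShuffle

open scoped BigOperators

section Prob

variable {α β ι : Type*}

/-- The probability of the event `A` under `p`, as a real number. -/
noncomputable def prob (p : PMF α) (A : Set α) : ℝ :=
  (p.toOuterMeasure A).toReal

theorem toOuterMeasure_le_one (p : PMF α) (A : Set α) : p.toOuterMeasure A ≤ 1 :=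
  (MeasureTheory.measure_mono A.subset_univ).trans_eq
    ((p.toOuterMeasure_apply_eq_one_iff _).2 p.support.subset_univ)

theorem toOuterMeasure_ne_top (p : PMF α) (A : Set α) : p.toOuterMeasure A ≠ ⊤ :=
  ((toOuterMeasure_le_one p A).trans_lt ENNReal.one_lt_top).ne

theorem prob_nonneg (p : PMF α) (A : Set α) : 0 ≤ prob p A :=
  ENNReal.toReal_nonneg

theorem prob_le_one (p : PMF α) (A : Set α) : prob p A ≤ 1 :=
  ENNReal.toReal_le_of_le_ofReal zero_le_one (by simpa using toOuterMeasure_le_one p A)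

theorem prob_mono (p : PMF α) {A B : Set α} (h : A ⊆ B) : prob p A ≤ prob p B :=
  ENNReal.toReal_mono (toOuterMeasure_ne_top p B) (MeasureTheory.measure_mono h)

theorem prob_map (f : α → β) (p : PMF α) (A : Set β) : prob (p.map f) A = prob p (f ⁻¹' A) := by
  rw [prob, PMF.toOuterMeasure_map_apply, prob]

theorem prob_uniform_bind [Fintype ι] [Nonempty ι] (q : ι → PMF α) (A : Set α) :
    prob ((PMF.uniformOfFintype ι).bind q) A = 𝔼 i, prob (q i) A := by
  simp only [prob, PMF.toOuterMeasure_bind_apply, tsum_fintype, PMF.uniformOfFintype_apply]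
  rw [← Finset.mul_sum, ENNReal.toReal_mul,
    ENNReal.toReal_sum fun i _ => toOuterMeasure_ne_top (q i) A, Fintype.expect_eq_sum_div_card,
    ENNReal.toReal_inv, ENNReal.toReal_natCast, inv_mul_eq_div]

theorem one_sub_sum_prob_le (p : PMF α) (s : Finset ι) (A : ι → Set α) :
    1 - ∑ i ∈ s, prob p (A i) ≤ prob p {a | ∀ i ∈ s, a ∉ A i} := by
  have hcover : {a | ∀ i ∈ s, a ∉ A i} ∪ ⋃ i ∈ s, A i = Set.univ := by
    ext a
    simp only [Set.mem_union, Set.mem_ofPred_eq, Set.mem_iUnion, Set.mem_univ, iff_true]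
    grind
  have hunion : 1 ≤ p.toOuterMeasure {a | ∀ i ∈ s, a ∉ A i} + ∑ i ∈ s, p.toOuterMeasure (A i) :=
    calc 1 = p.toOuterMeasure ({a | ∀ i ∈ s, a ∉ A i} ∪ ⋃ i ∈ s, A i) := by
          rw [hcover, (p.toOuterMeasure_apply_eq_one_iff _).2 p.support.subset_univ]
      _ ≤ _ := (MeasureTheory.measure_union_le _ _).trans
          (by gcongr; exact MeasureTheory.measure_biUnion_finset_le s A)
  have hreal := ENNReal.toReal_mono (ENNReal.add_ne_top.2 ⟨toOuterMeasure_ne_top p _,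
    ENNReal.sum_ne_top.2 fun i _ => toOuterMeasure_ne_top p (A i)⟩) hunion
  rw [ENNReal.toReal_one, ENNReal.toReal_add (toOuterMeasure_ne_top p _)
    (ENNReal.sum_ne_top.2 fun i _ => toOuterMeasure_ne_top p (A i)),
    ENNReal.toReal_sum fun i _ => toOuterMeasure_ne_top p (A i)] at hreal
  exact sub_le_iff_le_add.2 hreal

theorem uniform_map_perm [Fintype α] [Nonempty α] (e : Perm α) :
    (PMF.uniformOfFintype α).map e = PMF.uniformOfFintype α := by
  classical
  ext a
  rw [PMF.map_apply, tsum_fintype, Fintype.sum_eq_single (e.symm a)]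
  · simp
  · intro b hb
    rw [if_neg]
    rintro rfl
    exact hb (e.symm_apply_apply b).symm

theorem prob_uniform_stabilizer {G X : Type*} [Group G] [Fintype G] [MulAction G X]
    [MulAction.IsPretransitive G X] (x : X) :
    prob (PMF.uniformOfFintype G) (MulAction.stabilizer G x : Set G) = 1 / Nat.card X := by
  classical
  have hcard := (MulAction.stabilizer G x).index_mul_card
  rw [MulAction.index_stabilizer_of_transitive, Nat.card_eq_fintype_card (α := G)] at hcard
  have hpos : (0 : ℝ) < Nat.card (MulAction.stabilizer G x) := by exact_mod_cast Nat.card_pos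
  rw [prob, PMF.toOuterMeasure_uniformOfFintype_apply, ← hcard, ENNReal.toReal_div,
    ENNReal.toReal_natCast, ENNReal.toReal_natCast, Nat.cast_mul, ← Nat.card_eq_fintype_card]
  rw [one_div]
  exact div_mul_cancel_right₀ hpos.ne' _

theorem abs_prob_sub_prob_le_one (p q : PMF α) (A : Set α) : |prob p A - prob q A| ≤ 1 :=
  abs_sub_le_of_nonneg_of_le (prob_nonneg p A) (prob_le_one p A) (prob_nonneg q A)
    (prob_le_one q A)

theorem abs_prob_sub_prob_le_tvDist (p q : PMF α) (A : Set α) :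
    |prob p A - prob q A| ≤ tvDist p q :=
  le_ciSup (f := fun A => |prob p A - prob q A|)
    ⟨1, Set.forall_mem_range.2 fun B => abs_prob_sub_prob_le_one p q B⟩ A

theorem tvDist_nonneg (p q : PMF α) : 0 ≤ tvDist p q :=
  Real.iSup_nonneg fun _ => abs_nonneg _

theorem tvDist_le_one (p q : PMF α) : tvDist p q ≤ 1 :=
  ciSup_le fun A => abs_prob_sub_prob_le_one p q A

theorem tvDist_self (p : PMF α) : tvDist p p = 0 := by
  simp [tvDist]

-- The bijections `e` and `f` couple the two uniform choices.
theorem tvDist_uniform_bind_le [Fintype ι] [Nonempty ι] (p q : ι → PMF α) (e f : Perm ι) :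
    tvDist ((PMF.uniformOfFintype ι).bind p) ((PMF.uniformOfFintype ι).bind q) ≤
      𝔼 i, tvDist (p (e i)) (q (f i)) := by
  refine ciSup_le fun A => ?_
  change |prob _ A - prob _ A| ≤ _
  rw [prob_uniform_bind, prob_uniform_bind,
    ← Fintype.expect_equiv e (fun i => prob (p (e i)) A) (fun i => prob (p i) A) fun _ => rfl,
    ← Fintype.expect_equiv f (fun i => prob (q (f i)) A) (fun i => prob (q i) A) fun _ => rfl,
    ← Finset.expect_sub_distrib]
  exact (Finset.abs_expect_le _ _).trans
    (Finset.expect_le_expect fun i _ => abs_prob_sub_prob_le_tvDist (p (e i)) (q (f i)) A)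

end Prob

section PartialDist

variable (P : Shuffle) {n k : ℕ}

theorem tvDist_le_cardDist (S : Finset (Fin n)) (t : ℕ) (σ : Perm (Fin n)) :
    tvDist (locationLaw S (P n σ t)) (locationLaw S (PMF.uniformOfFintype (Perm (Fin n)))) ≤
      cardDist P S t :=
  le_ciSup (f := fun σ => tvDist (locationLaw S (P n σ t)) (locationLaw S
    (PMF.uniformOfFintype (Perm (Fin n))))) (Set.finite_range _).bddAbove σ

theorem cardDist_le_partialDist (S : Finset (Fin n)) (t : ℝ) :
    cardDist P S ⌊t⌋₊ ≤ partialDist P n S.card t :=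
  le_ciSup (f := fun S' : {S' : Finset (Fin n) // S'.card = S.card} => cardDist P S'.1 ⌊t⌋₊)
    (Set.finite_range _).bddAbove ⟨S, rfl⟩

theorem partialDist_le {t b : ℝ} (hb : 0 ≤ b)
    (h : ∀ S : Finset (Fin n), S.card = k → cardDist P S ⌊t⌋₊ ≤ b) : partialDist P n k t ≤ b :=
  Real.iSup_le (fun S => h S.1 S.2) hb

theorem partialDist_nonneg (n k : ℕ) (t : ℝ) : 0 ≤ partialDist P n k t :=
  Real.iSup_nonneg fun _ => Real.iSup_nonneg fun _ => tvDist_nonneg _ _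

theorem partialDist_le_one (n k : ℕ) (t : ℝ) : partialDist P n k t ≤ 1 :=
  partialDist_le P zero_le_one fun _ _ => ciSup_le fun _ => tvDist_le_one _ _

theorem locationLaw_empty (p : PMF (Perm (Fin n))) : locationLaw ∅ p = PMF.pure isEmptyElim := by
  rw [locationLaw, ← PMF.map_const p]
  congr 1
  funext σ
  exact Subsingleton.elim _ _

theorem partialDist_zero (n : ℕ) (t : ℝ) : partialDist P n 0 t = 0 := by
  refine le_antisymm (partialDist_le P le_rfl fun S hS => ciSup_le fun σ => ?_)
    (partialDist_nonneg P n 0 t)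
  rw [Finset.card_eq_zero.1 hS, locationLaw_empty, locationLaw_empty, tvDist_self]

theorem partialDist_isBoundedUnder_le (k : ℕ → ℕ) (s : ℕ → ℝ) :
    IsBoundedUnder (· ≤ ·) atTop fun n => partialDist P n (k n) (s n) :=
  isBoundedUnder_of ⟨1, fun n => partialDist_le_one P n (k n) (s n)⟩

theorem partialDist_isBoundedUnder_ge (k : ℕ → ℕ) (s : ℕ → ℝ) :
    IsBoundedUnder (· ≥ ·) atTop fun n => partialDist P n (k n) (s n) :=
  isBoundedUnder_of ⟨0, fun n => partialDist_nonneg P n (k n) (s n)⟩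

end PartialDist

section Expect

variable {ι : Type*} [Fintype ι] [DecidableEq ι]

theorem expect_indicator (A : Finset ι) :
    𝔼 c, (if c ∈ A then (1 : ℝ) else 0) = A.card / Fintype.card ι := by
  rw [Fintype.expect_eq_sum_div_card, Finset.sum_boole, Finset.filter_univ_mem]

theorem expect_card_erase [Nonempty ι] (A : Finset ι) :
    𝔼 c, ((A.erase c).card : ℝ) = A.card * (1 - 1 / Fintype.card ι) := by
  have herase (c : ι) : ((A.erase c).card : ℝ) = A.card - if c ∈ A then 1 else 0 := by
    rw [eq_sub_iff_add_eq]
    split_ifs with hc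
    · exact_mod_cast Finset.card_erase_add_one hc
    · rw [Finset.erase_eq_of_notMem hc, add_zero]
  simp only [herase, Finset.expect_sub_distrib, expect_indicator,
    Finset.expect_const Finset.univ_nonempty]
  ring

theorem expect_pow_card_erase_le [Nonempty ι] (A : Finset ι) {a : ℝ} (h₀ : 0 ≤ a) (h₁ : a ≤ 1) :
    𝔼 c, a ^ (A.erase c).card ≤ (a + (1 - a) / Fintype.card ι) ^ A.card := by
  have herase (c : ι) : a ^ (A.erase c).card =
      a ^ A.card + (if c ∈ A then 1 else 0) * ((1 - a) * a ^ (A.card - 1)) := by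
    split_ifs with hc
    · rw [← Finset.card_erase_of_mem hc, ← Finset.card_erase_add_one hc]
      ring
    · rw [Finset.erase_eq_of_notMem hc, zero_mul, add_zero]
  calc 𝔼 c, a ^ (A.erase c).card
      = a ^ A.card + A.card * a ^ (A.card - 1) * ((1 - a) / Fintype.card ι) := by
        simp only [herase, Finset.expect_add_distrib, ← Finset.expect_mul, expect_indicator,
          Finset.expect_const Finset.univ_nonempty]
        ring
    _ ≤ (a + (1 - a) / Fintype.card ι) ^ A.card :=
        pow_add_mul_le_add_pow h₀
          (add_nonneg (by positivity) (div_nonneg (sub_nonneg.2 h₁) (by positivity))) _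

end Expect

section TopToRandom

variable {n : ℕ} [NeZero n]

theorem topToRandomStep_eq_map (σ : Perm (Fin n)) :
    topToRandomStep n σ = (PMF.uniformOfFintype (Fin n)).map fun r => σ * swap 0 r := by
  cases n with
  | zero => exact absurd rfl (NeZero.ne 0)
  | succ m => rfl

theorem topToRandom_succ_eq_bind (σ : Perm (Fin n)) (t : ℕ) :
    topToRandom n σ (t + 1) =
      (PMF.uniformOfFintype (Fin n)).bind fun r => topToRandom n (σ * swap 0 r) t := by
  induction t with
  | zero =>
    simp only [topToRandom, PMF.pure_bind, topToRandomStep_eq_map]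
    rfl
  | succ t ih => rw [topToRandom, ih, PMF.bind_bind]; rfl

theorem uniform_bind_topToRandom (t : ℕ) :
    ((PMF.uniformOfFintype (Perm (Fin n))).bind fun σ => topToRandom n σ t) =
      PMF.uniformOfFintype (Perm (Fin n)) := by
  induction t with
  | zero => exact PMF.bind_pure _
  | succ t ih =>
    have hshift (r : Fin n) : ((PMF.uniformOfFintype (Perm (Fin n))).bind fun σ =>
        topToRandom n (σ * swap 0 r) t) = PMF.uniformOfFintype (Perm (Fin n)) := by
      conv_rhs => rw [← ih, ← uniform_map_perm (Equiv.mulRight (swap 0 r)), PMF.bind_map]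
      rfl
    simp only [topToRandom_succ_eq_bind]
    rw [PMF.bind_comm]
    simp only [hshift, PMF.bind_const]

theorem locationLaw_topToRandom_succ (S : Finset (Fin n)) (σ : Perm (Fin n)) (t : ℕ) :
    locationLaw S (topToRandom n σ (t + 1)) = (PMF.uniformOfFintype (Fin n)).bind fun r =>
      locationLaw S (topToRandom n (σ * swap 0 r) t) := by
  rw [topToRandom_succ_eq_bind, locationLaw, PMF.map_bind]
  rfl

theorem locationLaw_uniform_eq_bind (S : Finset (Fin n)) (t : ℕ) :
    locationLaw S (PMF.uniformOfFintype (Perm (Fin n))) =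
      (PMF.uniformOfFintype (Perm (Fin n))).bind fun τ =>
        locationLaw S (topToRandom n τ t) := by
  rw [← uniform_bind_topToRandom t, locationLaw, PMF.map_bind, uniform_bind_topToRandom]
  rfl

theorem cardDist_topToRandom_antitone (S : Finset (Fin n)) :
    Antitone (cardDist topToRandom S) := by
  refine antitone_nat_of_succ_le fun t => ciSup_le fun σ => ?_
  rw [locationLaw_topToRandom_succ,
    ← PMF.bind_const (PMF.uniformOfFintype (Fin n)) (locationLaw S _)]
  refine (tvDist_uniform_bind_le _ _ (Equiv.refl _) (Equiv.refl _)).trans ?_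
  exact Finset.expect_le Finset.univ_nonempty fun r _ =>
    tvDist_le_cardDist topToRandom S t (σ * swap 0 r)

theorem partialDist_topToRandom_antitone (k : ℕ) : Antitone (partialDist topToRandom n k) :=
  fun _ _ hst => partialDist_le _ (partialDist_nonneg _ _ _ _) fun S hS =>
    (cardDist_topToRandom_antitone S (Nat.floor_mono hst)).trans
      (hS ▸ cardDist_le_partialDist topToRandom S _)

end TopToRandom

section Coupling

variable {n : ℕ}

/-- The cards of `S` whose locations in the two decks `σ` and `τ` differ. -/
def unmatched (S : Finset (Fin n)) (σ τ : Perm (Fin n)) : Finset (Fin n) :=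
  S.filter fun c => σ⁻¹ c ≠ τ⁻¹ c

theorem unmatched_mul_right (S : Finset (Fin n)) (σ τ ρ : Perm (Fin n)) :
    unmatched S (σ * ρ) (τ * ρ) = unmatched S σ τ := by
  simp [unmatched]

theorem mul_swap_zero_apply_zero [NeZero n] (σ : Perm (Fin n)) (r : Fin n) :
    (σ * swap 0 r) 0 = σ r := by
  simp

theorem inv_mul_swap_zero_apply [NeZero n] {σ : Perm (Fin n)} {c r : Fin n} (h₀ : c ≠ σ 0)
    (hr : c ≠ σ r) : (σ * swap 0 r)⁻¹ c = σ⁻¹ c := by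
  rw [mul_inv_rev, swap_inv, Perm.mul_apply, swap_apply_of_ne_of_ne] <;>
    rwa [Ne, Perm.inv_eq_iff_eq]

theorem unmatched_mul_swap_subset [NeZero n] {S : Finset (Fin n)} {σ τ : Perm (Fin n)}
    (hσ : σ 0 ∉ S) (hτ : τ 0 ∉ S) (c : Fin n) :
    unmatched S (σ * swap 0 (σ⁻¹ c)) (τ * swap 0 (τ⁻¹ c)) ⊆ (unmatched S σ τ).erase c := by
  intro x hx
  obtain ⟨hxS, hne⟩ := Finset.mem_filter.1 hx
  have hxc : x ≠ c := by
    rintro rfl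
    simp at hne
  rw [inv_mul_swap_zero_apply (ne_of_mem_of_not_mem hxS hσ) (by simpa using hxc),
    inv_mul_swap_zero_apply (ne_of_mem_of_not_mem hxS hτ) (by simpa using hxc)] at hne
  exact Finset.mem_erase.2 ⟨hxc, Finset.mem_filter.2 ⟨hxS, hne⟩⟩

/-- The distance between the laws of the locations of the cards of `S` after `t` shuffles of the
decks `σ` and `τ`. -/
noncomputable def pairDist (S : Finset (Fin n)) (t : ℕ) (σ τ : Perm (Fin n)) : ℝ :=
  tvDist (locationLaw S (topToRandom n σ t)) (locationLaw S (topToRandom n τ t))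

theorem pairDist_zero_le (S : Finset (Fin n)) (σ τ : Perm (Fin n)) :
    pairDist S 0 σ τ ≤ (unmatched S σ τ).card := by
  rcases (unmatched S σ τ).eq_empty_or_nonempty with hempty | hne
  · have hlaw : locationLaw S (topToRandom n σ 0) = locationLaw S (topToRandom n τ 0) := by
      simp only [locationLaw, topToRandom, PMF.pure_map]
      congr 1
      funext c
      exact not_not.1 (Finset.filter_eq_empty_iff.1 hempty c.2)
    rw [pairDist, hlaw, tvDist_self]
    exact Nat.cast_nonneg _
  · exact (tvDist_le_one _ _).trans (by exact_mod_cast hne.card_pos)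

variable [NeZero n]

theorem pairDist_succ_le (S : Finset (Fin n)) (t : ℕ) (σ τ : Perm (Fin n)) (e f : Perm (Fin n)) :
    pairDist S (t + 1) σ τ ≤ 𝔼 i, pairDist S t (σ * swap 0 (e i)) (τ * swap 0 (f i)) := by
  rw [pairDist, locationLaw_topToRandom_succ, locationLaw_topToRandom_succ]
  exact tvDist_uniform_bind_le _ _ e f

/-- An upper bound for `pairDist S t σ τ` obtained by coupling. An unmatched card stays so with
probability `1 - 1 / n` in a step, except when a card of `S` is on top, which costs at most
`#S / n` per deck; the middle term accounts for the future steps at which this happens. -/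
noncomputable def couplingPotential (S : Finset (Fin n)) (t : ℕ) (σ τ : Perm (Fin n)) : ℝ :=
  (unmatched S σ τ).card * (1 - 1 / n) ^ t + t * (2 * (S.card / n) ^ 2) +
    ((if σ 0 ∈ S then 1 else 0) + if τ 0 ∈ S then 1 else 0) * (S.card / n)

theorem expect_couplingPotential_mul_swap_le (S : Finset (Fin n)) (t : ℕ) {σ τ : Perm (Fin n)}
    (hS : σ 0 ∈ S ∨ τ 0 ∈ S) :
    𝔼 r, couplingPotential S t (σ * swap 0 r) (τ * swap 0 r) ≤
      couplingPotential S (t + 1) σ τ := by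
  have htop (σ : Perm (Fin n)) : 𝔼 r, (if σ r ∈ S then (1 : ℝ) else 0) = S.card / n := by
    rw [Fintype.expect_equiv σ _ (fun c => if c ∈ S then (1 : ℝ) else 0) fun _ => rfl,
      expect_indicator, Fintype.card_fin]
  have hone : (1 : ℝ) ≤ (if σ 0 ∈ S then 1 else 0) + if τ 0 ∈ S then 1 else 0 := by
    rcases hS with h | h <;> rw [if_pos h] <;> split_ifs <;> norm_num
  have hloss : (unmatched S σ τ).card * (1 - 1 / n : ℝ) ^ t * (1 / n) ≤ S.card / n := by
    rw [mul_one_div]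
    gcongr
    exact (mul_le_of_le_one_right (Nat.cast_nonneg _) (pow_le_one₀
      (Nat.one_sub_one_div_cast_nonneg n) (Nat.one_sub_one_div_cast_le_one n))).trans
      (by exact_mod_cast Finset.card_filter_le _ _)
  simp only [couplingPotential, unmatched_mul_right, mul_swap_zero_apply_zero,
    Finset.expect_add_distrib, ← Finset.expect_mul, Finset.expect_const Finset.univ_nonempty, htop]
  have := mul_le_mul_of_nonneg_right hone (by positivity : (0 : ℝ) ≤ S.card / n)
  push_cast
  rw [pow_succ (1 - 1 / n : ℝ)]
  linarith

theorem expect_couplingPotential_mul_swap_inv_le (S : Finset (Fin n)) (t : ℕ)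
    {σ τ : Perm (Fin n)} (hσ : σ 0 ∉ S) (hτ : τ 0 ∉ S) :
    𝔼 c, couplingPotential S t (σ * swap 0 (σ⁻¹ c)) (τ * swap 0 (τ⁻¹ c)) ≤
      couplingPotential S (t + 1) σ τ := by
  calc 𝔼 c, couplingPotential S t (σ * swap 0 (σ⁻¹ c)) (τ * swap 0 (τ⁻¹ c))
      ≤ 𝔼 c, (((unmatched S σ τ).erase c).card * (1 - 1 / n : ℝ) ^ t +
          t * (2 * (S.card / n : ℝ) ^ 2) +
          ((if c ∈ S then 1 else 0) + if c ∈ S then 1 else 0) * (S.card / n : ℝ)) := by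
        refine Finset.expect_le_expect fun c _ => ?_
        simp only [couplingPotential, mul_swap_zero_apply_zero, Perm.coe_inv, apply_symm_apply]
        gcongr
        · exact pow_nonneg (Nat.one_sub_one_div_cast_nonneg n) t
        · exact unmatched_mul_swap_subset hσ hτ c
    _ = couplingPotential S (t + 1) σ τ := by
        simp only [couplingPotential, if_neg hσ, if_neg hτ, Finset.expect_add_distrib,
          ← Finset.expect_mul, Finset.expect_const Finset.univ_nonempty, expect_indicator,
          expect_card_erase, Fintype.card_fin]
        push_cast
        ring

-- If a card of `S` is on top, both decks use the same location; otherwise they bring the same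
-- card to the top, which matches it.
theorem pairDist_le_couplingPotential (S : Finset (Fin n)) (t : ℕ) (σ τ : Perm (Fin n)) :
    pairDist S t σ τ ≤ couplingPotential S t σ τ := by
  induction t generalizing σ τ with
  | zero =>
    refine (pairDist_zero_le S σ τ).trans ?_
    rw [couplingPotential, pow_zero, mul_one, add_assoc]
    exact le_add_of_nonneg_right (by positivity)
  | succ t ih =>
    by_cases hS : σ 0 ∈ S ∨ τ 0 ∈ S
    · exact (pairDist_succ_le S t σ τ (Equiv.refl _) (Equiv.refl _)).trans
        ((Finset.expect_le_expect fun r _ => ih _ _).trans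
          (expect_couplingPotential_mul_swap_le S t hS))
    · obtain ⟨hσ, hτ⟩ := not_or.1 hS
      exact (pairDist_succ_le S t σ τ σ⁻¹ τ⁻¹).trans
        ((Finset.expect_le_expect fun c _ => ih _ _).trans
          (expect_couplingPotential_mul_swap_inv_le S t hσ hτ))

theorem couplingPotential_le (S : Finset (Fin n)) (t : ℕ) (σ τ : Perm (Fin n)) :
    couplingPotential S t σ τ ≤
      S.card * (1 - 1 / n) ^ t + t * (2 * (S.card / n) ^ 2) + 2 * (S.card / n) := by
  have htop (σ : Perm (Fin n)) : (if σ 0 ∈ S then (1 : ℝ) else 0) ≤ 1 := by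
    split_ifs <;> norm_num
  rw [couplingPotential, ← one_add_one_eq_two (R := ℝ)]
  gcongr
  · exact pow_nonneg (Nat.one_sub_one_div_cast_nonneg n) t
  · exact Finset.filter_subset _ _
  · exact htop σ
  · exact htop τ

theorem cardDist_topToRandom_le (S : Finset (Fin n)) (t : ℕ) :
    cardDist topToRandom S t ≤
      S.card * (1 - 1 / n) ^ t + t * (2 * (S.card / n) ^ 2) + 2 * (S.card / n) := by
  refine ciSup_le fun σ => ?_
  rw [locationLaw_uniform_eq_bind S t,
    ← PMF.bind_const (PMF.uniformOfFintype (Perm (Fin n))) (locationLaw S (topToRandom n σ t))]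
  exact (tvDist_uniform_bind_le _ _ (Equiv.refl _) (Equiv.refl _)).trans
    (Finset.expect_le Finset.univ_nonempty fun τ _ =>
      (pairDist_le_couplingPotential S t σ τ).trans (couplingPotential_le S t σ τ))

end Coupling

section CouponCollector

variable {n : ℕ}

theorem one_sub_card_div_le_prob_uniform (W : Finset (Fin n)) :
    1 - W.card / (n : ℝ) ≤
      prob (PMF.uniformOfFintype (Perm (Fin n))) {τ : Perm (Fin n) | ∀ c ∈ W, τ⁻¹ c ≠ c} := by
  have hfix (c : Fin n) :
      prob (PMF.uniformOfFintype (Perm (Fin n))) {τ : Perm (Fin n) | τ⁻¹ c = c} = 1 / n := by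
    have hstab : {τ : Perm (Fin n) | τ⁻¹ c = c} = MulAction.stabilizer (Perm (Fin n)) c := by
      ext τ
      rw [Set.mem_ofPred_eq, Perm.inv_eq_iff_eq, eq_comm]
      rfl
    rw [hstab, prob_uniform_stabilizer, Nat.card_eq_fintype_card, Fintype.card_fin]
  refine le_of_eq_of_le ?_ (one_sub_sum_prob_le _ W fun c => {τ : Perm (Fin n) | τ⁻¹ c = c})
  rw [Finset.sum_congr rfl fun c _ => hfix c, Finset.sum_const, nsmul_eq_mul, mul_one_div]

variable [NeZero n]

theorem prob_forall_mem_inv_ne_le {W : Finset (Fin n)} {σ : Perm (Fin n)} (hW : σ 0 ∉ W) (t : ℕ) :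
    prob (topToRandom n σ t) {τ | ∀ c ∈ W, τ⁻¹ c ≠ σ⁻¹ c} ≤ (1 - (1 - 1 / n) ^ t) ^ W.card := by
  induction t generalizing σ W with
  | zero =>
    rcases W.eq_empty_or_nonempty with rfl | ⟨c, hc⟩
    · simpa using prob_le_one _ _
    · rw [prob, topToRandom, PMF.toOuterMeasure_pure_apply, if_neg fun h => h c hc rfl]
      simp
  | succ t ih =>
    have hpow₀ : (0 : ℝ) ≤ (1 - 1 / n) ^ t := pow_nonneg (Nat.one_sub_one_div_cast_nonneg n) t
    have hpow₁ : (1 - 1 / n : ℝ) ^ t ≤ 1 :=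
      pow_le_one₀ (Nat.one_sub_one_div_cast_nonneg n) (Nat.one_sub_one_div_cast_le_one n)
    -- Only the card brought to the top and the former top card move.
    have hstep (r : Fin n) : prob (topToRandom n (σ * swap 0 r) t) {τ | ∀ c ∈ W, τ⁻¹ c ≠ σ⁻¹ c} ≤
        (1 - (1 - 1 / n) ^ t) ^ (W.erase (σ r)).card := by
      refine (prob_mono _ fun τ hτ c hc => ?_).trans (ih (σ := σ * swap 0 r) (by simp))
      obtain ⟨hcr, hcW⟩ := Finset.mem_erase.1 hc
      rw [inv_mul_swap_zero_apply (ne_of_mem_of_not_mem hcW hW) hcr]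
      exact hτ c hcW
    calc prob (topToRandom n σ (t + 1)) {τ | ∀ c ∈ W, τ⁻¹ c ≠ σ⁻¹ c}
        ≤ 𝔼 r, (1 - (1 - 1 / n : ℝ) ^ t) ^ (W.erase (σ r)).card := by
          rw [topToRandom_succ_eq_bind, prob_uniform_bind]
          exact Finset.expect_le_expect fun r _ => hstep r
      _ = 𝔼 c, (1 - (1 - 1 / n : ℝ) ^ t) ^ (W.erase c).card :=
          Fintype.expect_equiv σ _ _ fun _ => rfl
      _ ≤ _ := expect_pow_card_erase_le W (sub_nonneg.2 hpow₁) (sub_le_self 1 hpow₀)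
      _ = (1 - (1 - 1 / n) ^ (t + 1)) ^ W.card := by
          rw [Fintype.card_fin]
          congr 1
          ring

theorem le_cardDist_topToRandom {S : Finset (Fin n)} (hS : 0 ∉ S) (t : ℕ) :
    1 - S.card / n - (1 - (1 - 1 / n) ^ t) ^ S.card ≤ cardDist topToRandom S t := by
  have hpre : (fun (σ : Perm (Fin n)) (c : S) => σ⁻¹ (c : Fin n)) ⁻¹' {x | ∀ c, x c ≠ c} =
      {τ : Perm (Fin n) | ∀ c ∈ S, τ⁻¹ c ≠ c} := by
    ext τ
    simp
  have hunif := one_sub_card_div_le_prob_uniform S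
  have hchain : prob (topToRandom n 1 t) {τ : Perm (Fin n) | ∀ c ∈ S, τ⁻¹ c ≠ c} ≤ _ :=
    prob_forall_mem_inv_ne_le (σ := 1) hS t
  rw [← hpre, ← prob_map] at hunif hchain
  refine (sub_le_sub hunif hchain).trans ((le_abs_self _).trans ?_)
  rw [abs_sub_comm]
  exact (abs_prob_sub_prob_le_tvDist _ _ _).trans (tvDist_le_cardDist topToRandom S t 1)

end CouponCollector

section RealTime

theorem one_sub_one_div_pow_floor_le (n : ℕ) (s : ℝ) :
    (1 - 1 / n : ℝ) ^ ⌊s⌋₊ ≤ Real.exp (-((s - 1) / n)) := by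
  calc (1 - 1 / n : ℝ) ^ ⌊s⌋₊ ≤ Real.exp (-(1 / n)) ^ ⌊s⌋₊ :=
        pow_le_pow_left₀ (Nat.one_sub_one_div_cast_nonneg n) (Real.one_sub_le_exp_neg _) _
    _ = Real.exp (-(⌊s⌋₊ / n)) := by
        rw [← Real.exp_nat_mul]
        congr 1
        ring
    _ ≤ _ := by
        gcongr
        exact (Nat.sub_one_lt_floor s).le

theorem exp_neg_div_le_one_sub_one_div_pow_floor {n : ℕ} (hn : 2 ≤ n) {s : ℝ} (hs : 0 ≤ s) :
    Real.exp (-(s / (n - 1))) ≤ (1 - 1 / n : ℝ) ^ ⌊s⌋₊ := by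
  have hn' : (2 : ℝ) ≤ n := by exact_mod_cast hn
  have hn₁ : (0 : ℝ) < n - 1 := by linarith
  have hpos : (0 : ℝ) < 1 - 1 / n := by
    rw [sub_pos, div_lt_one] <;> linarith
  have hexp : Real.exp (-(1 / (n - 1))) ≤ 1 - 1 / (n : ℝ) := by
    rw [← Real.le_log_iff_exp_le hpos]
    refine le_of_eq_of_le ?_ (Real.one_sub_inv_le_log_of_pos hpos)
    field_simp
    ring
  calc Real.exp (-(s / (n - 1))) ≤ Real.exp (-(⌊s⌋₊ / (n - 1))) := by
        gcongr
        exact Nat.floor_le hs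
    _ = Real.exp (-(1 / (n - 1))) ^ ⌊s⌋₊ := by
        rw [← Real.exp_nat_mul]
        congr 1
        ring
    _ ≤ _ := pow_le_pow_left₀ (Real.exp_pos _).le hexp _

theorem partialDist_topToRandom_le {n : ℕ} [NeZero n] (k : ℕ) {s : ℝ} (hs : 0 ≤ s) :
    partialDist topToRandom n k s ≤
      k * Real.exp (-((s - 1) / n)) + s * (2 * (k / n) ^ 2) + 2 * (k / n) := by
  refine partialDist_le _ (by positivity) fun S hS => (cardDist_topToRandom_le S _).trans ?_
  rw [hS]
  gcongr
  · exact one_sub_one_div_pow_floor_le n s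
  · exact Nat.floor_le hs

theorem le_partialDist_topToRandom {n k : ℕ} (hk : k < n) (s : ℝ) :
    1 - k / n - (1 - (1 - 1 / n) ^ ⌊s⌋₊) ^ k ≤ partialDist topToRandom n k s := by
  have : NeZero n := ⟨hk.ne_bot⟩
  obtain ⟨S, hS, rfl⟩ := Finset.exists_subset_card_eq (s := Finset.univ.erase (0 : Fin n)) (n := k)
    (by rw [Finset.card_erase_of_mem (Finset.mem_univ 0), Finset.card_fin]; omega)
  exact (le_cardDist_topToRandom (fun h => Finset.notMem_erase 0 _ (hS h)) _).trans
    (cardDist_le_partialDist topToRandom S s)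

end RealTime

section Cutoff

theorem partialDist_topToRandom_add_mul_le {n k : ℕ} [NeZero n] (hk : k ≠ 0) {α : ℝ} (hα : 0 ≤ α) :
    partialDist topToRandom n k (n * Real.log k + α * n) ≤
      Real.exp (-α) * Real.exp (1 / n) + (Real.log k + α) * (2 * (k ^ 2 / n)) + 2 * (k / n) := by
  have hn₀ : (n : ℝ) ≠ 0 := NeZero.ne _
  have hk₀ : (0 : ℝ) < k := by positivity
  have hs : 0 ≤ n * Real.log k + α * n :=
    add_nonneg (mul_nonneg n.cast_nonneg (Real.log_natCast_nonneg k)) (by positivity)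
  refine (partialDist_topToRandom_le k hs).trans_eq ?_
  have hexponent :
      -((n * Real.log k + α * n - 1) / n) = -Real.log k + (-α + 1 / (n : ℝ)) := by
    field_simp
    ring
  rw [hexponent, Real.exp_add, Real.exp_add, Real.exp_neg (Real.log k), Real.exp_log hk₀,
    mul_inv_cancel_left₀ hk₀.ne']
  field_simp

theorem exp_mul_exp_le_mul_one_sub_one_div_pow {n k : ℕ} (hn : 2 ≤ n) {α : ℝ} (hα : α ≤ 0)
    (hk : Real.exp (-α) ≤ k) :
    Real.exp (-α) * Real.exp (-(2 * (k / n))) ≤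
      k * (1 - 1 / n : ℝ) ^ ⌊n * Real.log k + α * n⌋₊ := by
  have hn' : (2 : ℝ) ≤ n := by exact_mod_cast hn
  have hn₁ : (0 : ℝ) < (n : ℝ) - 1 := by linarith
  have hk₀ : (0 : ℝ) < k := (Real.exp_pos _).trans_le hk
  have hlog : 0 ≤ Real.log k + α := by
    linarith [(Real.le_log_iff_exp_le hk₀).2 hk]
  have hlog_le : Real.log k + α ≤ k := by
    linarith [Real.log_le_sub_one_of_pos hk₀]
  have hcorrection : (Real.log k + α) / ((n : ℝ) - 1) ≤ 2 * (k / n) := by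
    rw [mul_div_assoc', div_le_div_iff₀ hn₁ (by linarith)]
    nlinarith
  have hsplit : (n * Real.log k + α * n) / ((n : ℝ) - 1) =
      Real.log k + α + (Real.log k + α) / ((n : ℝ) - 1) := by
    field_simp
    ring
  have hs : 0 ≤ n * Real.log k + α * n := by nlinarith
  calc Real.exp (-α) * Real.exp (-(2 * (k / n)))
      = k * Real.exp (-Real.log k + (-α + -(2 * (k / n)))) := by
        rw [Real.exp_add, Real.exp_add, Real.exp_neg (Real.log k), Real.exp_log hk₀,
          mul_inv_cancel_left₀ hk₀.ne']
    _ ≤ k * Real.exp (-((n * Real.log k + α * n) / (n - 1))) := by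
        rw [hsplit]
        gcongr
        linarith
    _ ≤ _ := by
        gcongr
        exact exp_neg_div_le_one_sub_one_div_pow_floor hn hs

theorem le_partialDist_topToRandom_add_mul {n k : ℕ} (hn : 2 ≤ n) (hkn : k < n) {α : ℝ}
    (hα : α ≤ 0) (hk : Real.exp (-α) ≤ k) :
    1 - k / n - Real.exp (-(Real.exp (-α) * Real.exp (-(2 * (k / n))))) ≤
      partialDist topToRandom n k (n * Real.log k + α * n) := by
  refine le_trans ?_ (le_partialDist_topToRandom hkn _)
  have hle := exp_mul_exp_le_mul_one_sub_one_div_pow hn hα hk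
  set p : ℝ := (1 - 1 / n : ℝ) ^ ⌊n * Real.log k + α * n⌋₊
  have hp : p ≤ 1 :=
    pow_le_one₀ (Nat.one_sub_one_div_cast_nonneg n) (Nat.one_sub_one_div_cast_le_one n)
  gcongr
  calc (1 - p) ^ k ≤ Real.exp (-p) ^ k :=
        pow_le_pow_left₀ (sub_nonneg.2 hp) (Real.one_sub_le_exp_neg p) k
    _ = Real.exp (-(k * p)) := by rw [← Real.exp_nat_mul, mul_neg]
    _ ≤ _ := by gcongr

variable {k : ℕ → ℕ}

theorem tendsto_sq_mul_log_div
    (hk : (fun n : ℕ => (k n : ℝ)) =o[atTop]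
      (fun n : ℕ => ((n : ℝ) / Real.log (n : ℝ)) ^ (1 / 2 : ℝ))) :
    Tendsto (fun n : ℕ => (k n : ℝ) ^ 2 * Real.log n / n) atTop (𝓝 0) := by
  refine (hk.pow (n := 2) two_pos).tendsto_div_nhds_zero.congr fun n => ?_
  rw [← Real.sqrt_eq_rpow, Real.sq_sqrt (div_nonneg n.cast_nonneg (Real.log_natCast_nonneg n)),
    div_div_eq_mul_div]

theorem tendsto_sq_div
    (hk : (fun n : ℕ => (k n : ℝ)) =o[atTop]
      (fun n : ℕ => ((n : ℝ) / Real.log (n : ℝ)) ^ (1 / 2 : ℝ))) :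
    Tendsto (fun n : ℕ => (k n : ℝ) ^ 2 / n) atTop (𝓝 0) := by
  refine tendsto_of_tendsto_of_tendsto_of_le_of_le' tendsto_const_nhds
    (tendsto_sq_mul_log_div hk) (Eventually.of_forall fun n => by positivity) ?_
  have hlog : ∀ᶠ n : ℕ in atTop, 1 ≤ Real.log n :=
    (Real.tendsto_log_atTop.comp tendsto_natCast_atTop_atTop).eventually_ge_atTop 1
  filter_upwards [hlog] with n hn
  gcongr
  exact le_mul_of_one_le_right (sq_nonneg _) hn

theorem tendsto_div_of_tendsto_sq_div
    (hk : Tendsto (fun n : ℕ => (k n : ℝ) ^ 2 / n) atTop (𝓝 0)) :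
    Tendsto (fun n : ℕ => (k n : ℝ) / n) atTop (𝓝 0) := by
  refine squeeze_zero (fun n => by positivity) (fun n => ?_) hk
  gcongr
  exact_mod_cast Nat.le_self_pow two_ne_zero (k n)

theorem limsup_partialDist_topToRandom_le
    (hk : (fun n : ℕ => (k n : ℝ)) =o[atTop]
      (fun n : ℕ => ((n : ℝ) / Real.log (n : ℝ)) ^ (1 / 2 : ℝ)))
    (hk_top : Tendsto k atTop atTop) {α : ℝ} (hα : 0 ≤ α) :
    limsup (fun n : ℕ => partialDist topToRandom n (k n) (n * Real.log (k n) + α * n)) atTop ≤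
      Real.exp (-α) := by
  have hkn := tendsto_div_of_tendsto_sq_div (tendsto_sq_div hk)
  have hlim : Tendsto (fun n : ℕ => Real.exp (-α) * Real.exp (1 / (n : ℝ)) +
      (2 * ((k n : ℝ) ^ 2 * Real.log n / n) + 2 * α * ((k n : ℝ) ^ 2 / n)) +
      2 * ((k n : ℝ) / n)) atTop (𝓝 (Real.exp (-α))) := by
    have hexp : Tendsto (fun n : ℕ => Real.exp (1 / (n : ℝ))) atTop (𝓝 1) :=
      Real.exp_zero ▸ tendsto_one_div_atTop_nhds_zero_nat.rexp
    simpa using ((hexp.const_mul (Real.exp (-α))).add (((tendsto_sq_mul_log_div hk).const_mul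
      2).add ((tendsto_sq_div hk).const_mul (2 * α)))).add (hkn.const_mul 2)
  rw [← hlim.limsup_eq]
  refine limsup_le_limsup ?_ (partialDist_isBoundedUnder_ge _ _ _).isCoboundedUnder_le
    hlim.isBoundedUnder_le
  filter_upwards [eventually_ne_atTop 0, hk_top.eventually_ne_atTop 0,
    hkn.eventually_le_const zero_lt_one] with n hn hk₀ hkn_le
  have : NeZero n := ⟨hn⟩
  refine (partialDist_topToRandom_add_mul_le hk₀ hα).trans ?_
  have hlog : Real.log (k n) ≤ Real.log n := by
    gcongr
    rwa [div_le_one (by positivity), Nat.cast_le] at hkn_le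
  calc Real.exp (-α) * Real.exp (1 / n) + (Real.log (k n) + α) * (2 * ((k n : ℝ) ^ 2 / n)) +
        2 * (k n / n)
      ≤ Real.exp (-α) * Real.exp (1 / n) + (Real.log n + α) * (2 * ((k n : ℝ) ^ 2 / n)) +
        2 * (k n / n) := by gcongr
    _ = _ := by ring

theorem le_liminf_partialDist_topToRandom
    (hkn : Tendsto (fun n : ℕ => (k n : ℝ) / n) atTop (𝓝 0))
    (hk_top : Tendsto k atTop atTop) {α : ℝ} (hα : α ≤ 0) :
    1 - Real.exp (-Real.exp (-α)) ≤ liminf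
      (fun n : ℕ => partialDist topToRandom n (k n) (n * Real.log (k n) + α * n)) atTop := by
  have hlim : Tendsto (fun n : ℕ => 1 - (k n : ℝ) / n -
      Real.exp (-(Real.exp (-α) * Real.exp (-(2 * ((k n : ℝ) / n)))))) atTop
      (𝓝 (1 - Real.exp (-Real.exp (-α)))) := by
    have hcont : Continuous fun x : ℝ =>
        1 - x - Real.exp (-(Real.exp (-α) * Real.exp (-(2 * x)))) := by fun_prop
    simpa [Function.comp_def] using (hcont.tendsto 0).comp hkn
  rw [← hlim.liminf_eq]
  refine liminf_le_liminf ?_ hlim.isBoundedUnder_ge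
    (partialDist_isBoundedUnder_le _ _ _).isCoboundedUnder_ge
  filter_upwards [eventually_ge_atTop 2, hk_top.eventually_ge_atTop ⌈Real.exp (-α)⌉₊,
    hkn.eventually_lt_const zero_lt_one] with n hn hk hkn_lt
  rw [div_lt_one (by positivity), Nat.cast_lt] at hkn_lt
  exact le_partialDist_topToRandom_add_mul hn hkn_lt hα (Nat.ceil_le.1 hk)

theorem natCast_isLittleO_mul_log (hk_top : Tendsto k atTop atTop) :
    (fun n : ℕ => (n : ℝ)) =o[atTop] fun n => (n : ℝ) * Real.log (k n) := by
  have hlog : Tendsto (fun n => Real.log (k n : ℝ)) atTop atTop :=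
    Real.tendsto_log_atTop.comp (tendsto_natCast_atTop_atTop.comp hk_top)
  have hone : (fun _ : ℕ => (1 : ℝ)) =o[atTop] fun n => Real.log (k n : ℝ) :=
    isLittleO_const_left.2 (Or.inr (tendsto_norm_atTop_atTop.comp hlog))
  simpa using (isBigO_refl (fun n : ℕ => (n : ℝ)) atTop).mul_isLittleO hone

theorem hasPartialCutoff_topToRandom
    (hk : (fun n : ℕ => (k n : ℝ)) =o[atTop]
      (fun n : ℕ => ((n : ℝ) / Real.log (n : ℝ)) ^ (1 / 2 : ℝ)))
    (hk_top : Tendsto k atTop atTop) :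
    HasPartialCutoff topToRandom k (fun n => n * Real.log (k n)) (fun n => n) where
  window := natCast_isLittleO_mul_log hk_top
  upper := by
    refine tendsto_of_tendsto_of_tendsto_of_le_of_le' tendsto_const_nhds
      Real.tendsto_exp_neg_atTop_nhds_zero (Eventually.of_forall fun α => ?_) ?_
    · exact le_limsup_of_frequently_le
        (Eventually.of_forall fun n => partialDist_nonneg _ _ _ _).frequently
        (partialDist_isBoundedUnder_le _ _ _)
    · filter_upwards [eventually_ge_atTop 0] with α hα
      exact limsup_partialDist_topToRandom_le hk hk_top hα
  lower := by
    have hlim : Tendsto (fun α : ℝ => 1 - Real.exp (-Real.exp (-α))) atBot (𝓝 1) := by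
      simpa using (Real.tendsto_exp_neg_atTop_nhds_zero.comp
        (Real.tendsto_exp_atTop.comp tendsto_neg_atBot_atTop)).const_sub 1
    refine tendsto_of_tendsto_of_tendsto_of_le_of_le' hlim tendsto_const_nhds ?_
      (Eventually.of_forall fun α => ?_)
    · filter_upwards [eventually_le_atBot 0] with α hα
      exact le_liminf_partialDist_topToRandom (tendsto_div_of_tendsto_sq_div (tendsto_sq_div hk))
        hk_top hα
    · exact liminf_le_of_frequently_le
        (Eventually.of_forall fun n => partialDist_le_one _ _ _ _).frequently
        (partialDist_isBoundedUnder_ge _ _ _)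

end Cutoff

section NoCutoff

-- The window is negligible against `tmix`, so the two times differ at most by the factor
-- `(3 / 2) / (1 / 2)`.
theorem HasPartialCutoff.eventually_exists_times {P : Shuffle} {k : ℕ → ℕ} {tmix ω : ℕ → ℝ}
    (h : HasPartialCutoff P k tmix ω) {ε : ℝ} (hε : 0 < ε) :
    ∀ᶠ n in atTop, ∃ s s' : ℝ, s ≤ max 0 (3 * s') ∧
      partialDist P n (k n) s < ε ∧ 1 - ε < partialDist P n (k n) s' := by
  obtain ⟨α, hα⟩ := (h.upper.eventually_lt_const hε).exists
  obtain ⟨β, hβ⟩ := (h.lower.eventually_const_lt (sub_lt_self 1 hε)).exists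
  have hω (γ : ℝ) : ∀ᶠ n in atTop, |γ * ω n| ≤ 1 / 2 * |tmix n| :=
    (h.window.const_mul_left γ).def one_half_pos
  filter_upwards [hω α, hω β,
    eventually_lt_of_limsup_lt hα (partialDist_isBoundedUnder_le P k _),
    eventually_lt_of_lt_liminf hβ (partialDist_isBoundedUnder_ge P k _)] with n hαn hβn hlt hgt
  refine ⟨_, _, ?_, hlt, hgt⟩
  rw [abs_le] at hαn hβn
  rcases le_total 0 (tmix n) with ht | ht
  · rw [abs_of_nonneg ht] at hαn hβn
    exact le_max_of_le_right (by linarith)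
  · rw [abs_of_nonpos ht] at hαn
    exact le_max_of_le_left (by linarith)

theorem eventually_partialDist_topToRandom_le_half (K : ℕ) :
    ∀ᶠ n : ℕ in atTop, ∀ k < K, partialDist topToRandom n k ((K + 1) * n) ≤ 1 / 2 := by
  have hlim : Tendsto (fun n : ℕ => (K : ℝ) * Real.exp (-(K + 1) + 1 / (n : ℝ)) +
      2 * (K + 1) * K ^ 2 / (n : ℝ) + 2 * K / (n : ℝ)) atTop
      (𝓝 (K * Real.exp (-(K + 1)))) := by
    have hexp := (tendsto_one_div_atTop_nhds_zero_nat.const_add (-((K : ℝ) + 1))).rexp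
    simpa using ((hexp.const_mul (K : ℝ)).add
      (tendsto_const_div_atTop_nhds_zero_nat (2 * (K + 1) * (K : ℝ) ^ 2))).add
      (tendsto_const_div_atTop_nhds_zero_nat (2 * (K : ℝ)))
  have hlt : K * Real.exp (-((K : ℝ) + 1)) < 1 / 2 := by
    rw [Real.exp_neg, Real.exp_add, ← div_eq_mul_inv, div_lt_iff₀ (by positivity)]
    nlinarith [Real.add_one_le_exp (K : ℝ), Real.exp_one_gt_two]
  filter_upwards [hlim.eventually_le_const hlt, eventually_ne_atTop 0] with n hle hn k hk
  have : NeZero n := ⟨hn⟩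
  refine (partialDist_topToRandom_le k (by positivity)).trans (hle.trans' ?_)
  have hexponent : -((((K : ℝ) + 1) * n - 1) / n) = -(K + 1) + 1 / n := by
    field_simp
    ring
  have hmiddle : ((K : ℝ) + 1) * n * (2 * (k / n) ^ 2) = 2 * (K + 1) * k ^ 2 / n := by
    field_simp
  rw [hexponent, hmiddle, mul_div_assoc']
  gcongr

theorem exp_neg_two_mul_le_one_sub_one_div_pow_floor {n : ℕ} (hn : 2 ≤ n) {C s : ℝ} (hC : 0 ≤ C)
    (hs : s ≤ C * n) : Real.exp (-(2 * C)) ≤ (1 - 1 / n : ℝ) ^ ⌊s⌋₊ := by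
  have hn' : (2 : ℝ) ≤ n := by exact_mod_cast hn
  calc Real.exp (-(2 * C)) ≤ Real.exp (-(C * n / (n - 1))) := by
        gcongr
        rw [div_le_iff₀ (by linarith)]
        nlinarith
    _ ≤ (1 - 1 / n : ℝ) ^ ⌊C * n⌋₊ :=
        exp_neg_div_le_one_sub_one_div_pow_floor hn (by positivity)
    _ ≤ (1 - 1 / n : ℝ) ^ ⌊s⌋₊ := pow_le_pow_of_le_one (Nat.one_sub_one_div_cast_nonneg n)
        (Nat.one_sub_one_div_cast_le_one n) (Nat.floor_mono hs)

theorem eventually_le_partialDist_topToRandom (K : ℕ) {C : ℝ} (hC : 0 ≤ C) :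
    ∀ᶠ n : ℕ in atTop, ∀ k < K, k ≠ 0 → ∀ s ≤ C * n,
      Real.exp (-(2 * C)) / 2 ≤ partialDist topToRandom n k s := by
  filter_upwards [(tendsto_const_div_atTop_nhds_zero_nat (K : ℝ)).eventually_le_const
    (half_pos (Real.exp_pos (-(2 * C)))), eventually_ge_atTop 2, eventually_ge_atTop K]
    with n hKn hn hnK k hk hk₀ s hs
  refine le_trans ?_ (le_partialDist_topToRandom (hk.trans_le hnK) s)
  have hkn : (k : ℝ) / n ≤ K / n := by gcongr
  have hexp := exp_neg_two_mul_le_one_sub_one_div_pow_floor hn hC hs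
  have hpow₁ : (1 - 1 / n : ℝ) ^ ⌊s⌋₊ ≤ 1 :=
    pow_le_one₀ (Nat.one_sub_one_div_cast_nonneg n) (Nat.one_sub_one_div_cast_le_one n)
  have hpow : (1 - (1 - 1 / n : ℝ) ^ ⌊s⌋₊) ^ k ≤ 1 - (1 - 1 / n : ℝ) ^ ⌊s⌋₊ :=
    pow_le_of_le_one (sub_nonneg.2 hpow₁)
      (sub_le_self _ (pow_nonneg (Nat.one_sub_one_div_cast_nonneg n) _)) hk₀
  linarith

theorem not_hasPartialCutoff_topToRandom {k : ℕ → ℕ} (hk : ¬ Tendsto k atTop atTop)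
    (tmix ω : ℕ → ℝ) : ¬ HasPartialCutoff topToRandom k tmix ω := by
  intro h
  obtain ⟨K, hK⟩ : ∃ K, ∃ᶠ n in atTop, k n < K := by
    simpa only [tendsto_atTop, not_forall, not_eventually, not_le] using hk
  have hC : (0 : ℝ) ≤ 3 * (K + 1) := by positivity
  have hε : Real.exp (-(2 * (3 * ((K : ℝ) + 1)))) ≤ 1 := Real.exp_le_one_iff.2 (by linarith)
  obtain ⟨n, hkn, ⟨s, s', hss', hlt, hgt⟩, hhalf, hlow, hn⟩ := (hK.and_eventually
    ((h.eventually_exists_times (half_pos (Real.exp_pos (-(2 * (3 * ((K : ℝ) + 1))))))).and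
    ((eventually_partialDist_topToRandom_le_half K).and
    ((eventually_le_partialDist_topToRandom K hC).and (eventually_ne_atTop 0))))).exists
  have : NeZero n := ⟨hn⟩
  have hs' : s' < (K + 1) * n := by
    by_contra! hle
    linarith [partialDist_topToRandom_antitone (n := n) (k n) hle, hhalf (k n) hkn]
  have hk₀ : k n ≠ 0 := by
    intro h₀
    rw [h₀, partialDist_zero] at hgt
    linarith
  have hs : s ≤ 3 * (K + 1) * n :=
    hss'.trans (max_le (by positivity) (by linarith))
  exact hlt.not_ge (hlow (k n) hkn hk₀ s hs)

end NoCutoff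

end CardShuffle

theorem theorem3_general :
    (∀ k : ℕ → ℕ,
      (fun n : ℕ => (k n : ℝ)) =o[atTop]
        (fun n : ℕ => ((n : ℝ) / Real.log (n : ℝ)) ^ (1 / 2 : ℝ)) →
      Tendsto k atTop atTop →
      CardShuffle.HasPartialCutoff CardShuffle.topToRandom k
        (fun n : ℕ => (n : ℝ) * Real.log (k n : ℝ)) (fun n : ℕ => (n : ℝ))) ∧
    (∀ k : ℕ → ℕ, ¬ Tendsto k atTop atTop →
      ¬ ∃ tmix ω : ℕ → ℝ,
        CardShuffle.HasPartialCutoff CardShuffle.topToRandom k tmix ω) :=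
  ⟨fun _ hk hk_top => CardShuffle.hasPartialCutoff_topToRandom hk hk_top,
    fun _ hk ⟨tmix, ω, h⟩ => CardShuffle.not_hasPartialCutoff_topToRandom hk tmix ω h⟩

theorem theorem3 :
    (∀ k : ℕ → ℕ,
      (fun n : ℕ => (k n : ℝ)) =o[atTop]
        (fun n : ℕ => ((n : ℝ) / Real.log (n : ℝ)) ^ (1 / 2 : ℝ)) →
      Tendsto k atTop atTop →
      CardShuffle.HasPartialCutoff CardShuffle.topToRandom k
        (fun n : ℕ => (n : ℝ) * Real.log (k n : ℝ)) (fun n : ℕ => (n : ℝ))) ∧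
    (∀ (k : ℕ → ℕ) (K : ℕ), (∀ n, k n < K) →
      ¬ ∃ tmix ω : ℕ → ℝ,
        CardShuffle.HasPartialCutoff CardShuffle.topToRandom k tmix ω) := by
  refine theorem3_general.imp_right fun hgeneral k K hK => hgeneral k fun hk_top => ?_
  obtain ⟨n, hn⟩ := (hk_top.eventually_ge_atTop K).exists
  exact (hK n).not_ge hn
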